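/- Let $I=(i_1,\dots,i_k)$ be positive integers with $i_1+\dots+i_k=n$, and let $\mathrm{Fl}_I(\mathbb R)$ be the manifold of partial flags $0=E_0\subset E_1\subset\dots\subset E_k=\mathbb R^n$ with $\dim E_l=i_1+\dots+i_l$. Let $S_n^I$ be the set of maps $\tau:\{1,\dots,n\}\to\{1,\dots,k\}$ with $|\tau^{-1}(j)|=i_j$ for all $j$. Put $r_\tau[p,q]=\#\{j\le p\mid \tau(j)\ge q\}$, and write $\tau\prec\upsilon$ (Bruhat order, non-strict) if $r_\tau[p,q]\le r_\upsilon[p,q]$ for all $1\le p\le n$, $1\le q\le k$. For $\omega\in S_n^I$ let $E^\omega\in\mathrm{Fl}_I(\mathbb R)$ be the coordinate flag with $E^\omega_l=\langle e_i\mid \omega(i)\le l\rangle$. The Schubert cell $X_\omega=B_n^+\cdot E^\omega$ and the dual Schubert cell $X^\wedge_\omega=B_n^-\cdot E^\omega$ are its orbits under the groups of upper and lower triangular matrices in $\mathrm{SL}(n,\mathbb R)$. (Thus $\dim(\langle e_1,\dots,e_p\rangle\cap E_q)=\#\{i\le p\mid\omega(i)\le q\}$ for $E\in X_\omega$.) Proposition.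 For all $\psi,\omega\in S_n^I$, the Schubert cell $X_\psi$ meets the dual Schubert cell $X^\wedge_\omega$ if and only if $\omega\prec\psi$. When they meet, the intersection is transversal: $T_EX_\psi+T_EX^\wedge_\omega=T_E\mathrm{Fl}_I(\mathbb R)$ at every point $E\in X_\psi\cap X^\wedge_\omega$. -/

import Mathlib

noncomputable section

namespace FlagBruhat

/-- Multiset permutations `S_n^I`: maps `τ` from `n` positions to `k` letters that take the
letter `j` exactly `I j` times. -/
def MultisetPerm (n : ℕ) {k : ℕ} (I : Fin k → ℕ) : Type :=
  {τ : Fin n → Fin k // ∀ j, (Finset.univ.filter fun i => τ i = j).card = I j}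

/-- `r_τ[p, q] = #{i ≤ p | τ(i) ≥ q}`. -/
def rankNumber {n k : ℕ} {I : Fin k → ℕ} (τ : MultisetPerm n I) (p : Fin n) (q : Fin k) : ℕ :=
  (Finset.univ.filter fun i : Fin n => i ≤ p ∧ q ≤ τ.1 i).card

/-- The (non-strict) Bruhat order `τ ≺ υ` on `S_n^I`. -/
def BruhatLE {n k : ℕ} {I : Fin k → ℕ} (τ υ : MultisetPerm n I) : Prop :=
  ∀ (p : Fin n) (q : Fin k), rankNumber τ p q ≤ rankNumber υ p q

/-- Points of `Fl_I(ℝ)`: chains `V 0 ⊆ V 1 ⊆ … ⊆ V k` of subspaces of `ℝⁿ` such that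
`dim (V l)` is the sum of the first `l` entries of `I`.  When the entries of `I` add up to `n`,
the dimensions force `V 0 = 0` and `V k = ℝⁿ`. -/
@[ext]
structure PartialFlag (n : ℕ) {k : ℕ} (I : Fin k → ℕ) where
  V : Fin (k + 1) → Submodule ℝ (EuclideanSpace ℝ (Fin n))
  mono : Monotone V
  finrank_eq : ∀ l, Module.finrank ℝ (V l) =
    ∑ j ∈ Finset.univ.filter (fun j : Fin k => j.castSucc < l), I j

/-- A matrix of determinant one acts injectively on `ℝⁿ`. -/
theorem toEuclideanLin_injective {n : ℕ} (g : Matrix.SpecialLinearGroup (Fin n) ℝ) :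
    Function.Injective (Matrix.toEuclideanLin (g : Matrix (Fin n) (Fin n) ℝ)) := by
  intro x y h
  have h' : Matrix.toLin' (g : Matrix (Fin n) (Fin n) ℝ) x.ofLp
      = Matrix.toLin' (g : Matrix (Fin n) (Fin n) ℝ) y.ofLp := by
    have := congrArg WithLp.ofLp h
    simpa using this
  have hdet : IsUnit (g : Matrix (Fin n) (Fin n) ℝ) :=
    (Matrix.isUnit_iff_isUnit_det _).2 (by simp)
  rw [Matrix.toLin'_apply, Matrix.toLin'_apply] at h'
  exact WithLp.ofLp_injective 2 (Matrix.mulVec_injective_iff_isUnit.2 hdet h')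

/-- The action of `SL(n, ℝ)` on flags, `(g • E)_l = g (E_l)`. -/
def PartialFlag.act {n k : ℕ} {I : Fin k → ℕ} (g : Matrix.SpecialLinearGroup (Fin n) ℝ)
    (E : PartialFlag n I) : PartialFlag n I where
  V l := (E.V l).map (Matrix.toEuclideanLin (g : Matrix (Fin n) (Fin n) ℝ))
  mono _ _ h := Submodule.map_mono (E.mono h)
  finrank_eq l := by
    rw [← E.finrank_eq l]
    exact (LinearEquiv.finrank_eq
      (Submodule.equivMapOfInjective _ (toEuclideanLin_injective g) (E.V l))).symm

/-- The coordinate flag of `ω ∈ S_n^I`: its `l`-th space is spanned by the standard basis vectors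
`e_i` whose letter `ω(i)` is among the first `l` letters.  Hence it meets `⟨e_1, …, e_p⟩` in
dimension `#{i ≤ p | ω(i) ≤ l}` (positions and letters counted from `1`). -/
def coordFlag {n k : ℕ} {I : Fin k → ℕ} (ω : MultisetPerm n I) : PartialFlag n I where
  V l := Submodule.span ℝ
    ((fun i : Fin n => EuclideanSpace.single i (1 : ℝ)) '' {i | (ω.1 i).castSucc < l})
  mono _ _ h := Submodule.span_mono (Set.image_mono fun _ hi => lt_of_lt_of_le hi h)
  finrank_eq l := by
    classical
    have hli : LinearIndependent ℝ (fun i : Fin n => EuclideanSpace.single i (1 : ℝ)) := by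
      have h : (fun i : Fin n => EuclideanSpace.single i (1 : ℝ))
          = (EuclideanSpace.basisFun (Fin n) ℝ).toBasis := by
        funext i
        simp
      rw [h]
      exact (EuclideanSpace.basisFun (Fin n) ℝ).toBasis.linearIndependent
    have hli' := hli.comp (Subtype.val : {i : Fin n // (ω.1 i).castSucc < l} → Fin n)
      Subtype.val_injective
    have hset : (fun i : Fin n => EuclideanSpace.single i (1 : ℝ)) '' {i | (ω.1 i).castSucc < l}
        = Set.range ((fun i : Fin n => EuclideanSpace.single i (1 : ℝ)) ∘
          (Subtype.val : {i : Fin n // (ω.1 i).castSucc < l} → Fin n)) := by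
      rw [Set.range_comp, Subtype.range_coe_subtype]
    rw [hset, finrank_span_eq_card hli', Fintype.card_subtype]
    have hmaps : ∀ i ∈ (Finset.univ.filter fun i : Fin n => (ω.1 i).castSucc < l),
        ω.1 i ∈ Finset.univ.filter (fun j : Fin k => j.castSucc < l) := by
      intro i hi
      simpa using hi
    rw [Finset.card_eq_sum_card_fiberwise hmaps]
    refine Finset.sum_congr rfl fun j hj => ?_
    rw [← ω.2 j, Finset.filter_filter]
    congr 1
    ext i
    simp only [Finset.mem_filter, Finset.mem_univ, true_and] at hj ⊢
    exact ⟨fun h => h.2, fun h => ⟨h ▸ hj, h⟩⟩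

/-- `B_n^+`: the upper triangular matrices in `SL(n, ℝ)`. -/
def upperBorel (n : ℕ) : Subgroup (Matrix.SpecialLinearGroup (Fin n) ℝ) where
  carrier := {g | Matrix.BlockTriangular (g : Matrix (Fin n) (Fin n) ℝ) id}
  one_mem' := by simpa using Matrix.blockTriangular_one
  mul_mem' ha hb := by simpa using Matrix.BlockTriangular.mul ha hb
  inv_mem' {g} hg := by
    have : Invertible (g : Matrix (Fin n) (Fin n) ℝ) :=
      Matrix.invertibleOfIsUnitDet _ (by simp)
    have h := Matrix.blockTriangular_inv_of_blockTriangular hg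
    rw [Matrix.inv_def] at h
    simpa using h

/-- `B_n^-`: the lower triangular matrices in `SL(n, ℝ)`. -/
def lowerBorel (n : ℕ) : Subgroup (Matrix.SpecialLinearGroup (Fin n) ℝ) where
  carrier := {g | Matrix.BlockTriangular (g : Matrix (Fin n) (Fin n) ℝ) OrderDual.toDual}
  one_mem' := by simpa using Matrix.blockTriangular_one
  mul_mem' ha hb := by simpa using Matrix.BlockTriangular.mul ha hb
  inv_mem' {g} hg := by
    have : Invertible (g : Matrix (Fin n) (Fin n) ℝ) :=
      Matrix.invertibleOfIsUnitDet _ (by simp)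
    have h := Matrix.blockTriangular_inv_of_blockTriangular hg
    rw [Matrix.inv_def] at h
    simpa using h

/-- The Schubert cell `X_ω`: the `B_n^+`-orbit of the coordinate flag of `ω`. -/
def schubertCell {n k : ℕ} {I : Fin k → ℕ} (ω : MultisetPerm n I) : Set (PartialFlag n I) :=
  {E | ∃ b ∈ upperBorel n, E = (coordFlag ω).act b}

/-- The dual Schubert cell `X^∧_ω`: the `B_n^-`-orbit of the coordinate flag of `ω`. -/
def dualSchubertCell {n k : ℕ} {I : Fin k → ℕ} (ω : MultisetPerm n I) : Set (PartialFlag n I) :=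
  {E | ∃ b ∈ lowerBorel n, E = (coordFlag ω).act b}

/-- The smooth embedding of `Fl_I(ℝ)` into a vector space that gives it its usual manifold
structure: a flag goes to the tuple of orthogonal projections onto its members.  (A fixed linear
combination of these projections, with distinct prescribed eigenvalues, is the usual identification
of `Fl_I(ℝ)` with an isospectral set of symmetric matrices.) -/
def PartialFlag.proj {n k : ℕ} {I : Fin k → ℕ} (E : PartialFlag n I) :
    Fin (k + 1) → (EuclideanSpace ℝ (Fin n) →L[ℝ] EuclideanSpace ℝ (Fin n)) :=
  fun l => (E.V l).starProjection

/-- The tangent vectors at `E` to a subset `X` of `Fl_I(ℝ)`: the velocities at time `0` of smooth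
curves that start at `E` and stay in `X`.  For an embedded submanifold `X` this is its tangent
space, and for `X = Set.univ` it is the tangent space of `Fl_I(ℝ)`. -/
def tangentVectors {n k : ℕ} {I : Fin k → ℕ} (X : Set (PartialFlag n I)) (E : PartialFlag n I) :
    Set (Fin (k + 1) → (EuclideanSpace ℝ (Fin n) →L[ℝ] EuclideanSpace ℝ (Fin n))) :=
  {v | ∃ γ : ℝ → PartialFlag n I, γ 0 = E ∧ (∀ t, γ t ∈ X) ∧
    ContDiff ℝ ((⊤ : ℕ∞) : WithTop ℕ∞) (fun t => (γ t).proj) ∧ HasDerivAt (fun t => (γ t).proj) v 0}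

/-- `X` and `Y` intersect transversally in `Fl_I(ℝ)`: at every common point `E`,
`T_E X + T_E Y = T_E Fl_I(ℝ)`. -/
def IntersectTransversally {n k : ℕ} {I : Fin k → ℕ} (X Y : Set (PartialFlag n I)) : Prop :=
  ∀ E ∈ X ∩ Y, {v | ∃ x ∈ tangentVectors X E, ∃ y ∈ tangentVectors Y E, x + y = v}
    = tangentVectors Set.univ E

end FlagBruhat

end

/-! A common point of the cells is a flag u·E^ψ = l·E^ω with u upper and l lower triangular. So the
cells meet iff some g = l⁻¹u in the big cell B⁻B⁺ carries E^ψ to E^ω, which in entries says g_ij = 0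
whenever ψ(j) < ω(i) (`act_coordFlag_eq_iff`).

Necessity: the leading minors of such a g are nonzero, and a nonzero Leibniz term of the p-th one
matches the first p positions so that letters of ω are dominated by letters of ψ
(`bruhatLE_of_lower_mul_upper`).

Sufficiency: ω is joined to ψ by transpositions that increase the order and stay below ψ
(`BruhatLE.exists_swap`). Incidence with ψ descends along each of them
(`BigCellIncident.of_comp_swap`), because the big cell contains a neighbourhood of 1 and conjugation
by a torus contracts lower unitriangular matrices to 1.

Transversality uses no combinatorics. The cells are orbits, every endomorphism is upper plus lower
triangular, and scalars act trivially on flags, so trace zero can be arranged. It remains to see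
that every tangent vector of the flag manifold comes from an endomorphism (`exists_eq_velocity`) and
to differentiate the orthogonal projection onto a moving subspace g_t(V)
(`hasDerivAt_starProjection_map`). -/

namespace FlagBruhat

open Finset

/-! ### Bruhat order: chains of transpositions. -/

section Combinatorics

variable {n k : ℕ} {I : Fin k → ℕ}

theorem MultisetPerm.sum_comp_eq (τ : MultisetPerm n I) (F : Fin k → ℕ) :
    ∑ m, F (τ.1 m) = ∑ j, I j * F j := by
  rw [← Finset.sum_fiberwise univ τ.1]
  refine Finset.sum_congr rfl fun j _ => ?_
  rw [← τ.2 j, Finset.sum_congr rfl (g := fun _ => F j), Finset.sum_const, smul_eq_mul]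
  intro x hx
  rw [(Finset.mem_filter.1 hx).2]

/-- Rearranging the positions of a multiset permutation. -/
def MultisetPerm.comp (τ : MultisetPerm n I) (σ : Equiv.Perm (Fin n)) : MultisetPerm n I :=
  ⟨fun m => τ.1 (σ m), fun j => by
    rw [← τ.2 j]
    exact Finset.card_equiv σ (by simp)⟩

theorem rankNumber_eq_sum (τ : MultisetPerm n I) (p : Fin n) (q : Fin k) :
    rankNumber τ p q = ∑ m, if m ≤ p ∧ q ≤ τ.1 m then 1 else 0 := by
  rw [rankNumber, Finset.card_filter]

/-- The strict threshold c is the threshold c + 1; when c is the last letter, both counts are zero.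
-/
theorem BruhatLE.sum_gt_le {ω ψ : MultisetPerm n I} (h : BruhatLE ω ψ) (p : Fin n) (c : Fin k) :
    (∑ m, if m ≤ p ∧ c < ω.1 m then 1 else 0) ≤ ∑ m, if m ≤ p ∧ c < ψ.1 m then 1 else 0 := by
  by_cases hc : c.1 + 1 < k
  · have key : ∀ x : Fin k, c < x ↔ (⟨c.1 + 1, hc⟩ : Fin k) ≤ x := fun x => by
      rw [Fin.lt_def, Fin.le_def]; exact Nat.lt_iff_add_one_le
    simpa only [rankNumber_eq_sum, key] using h p ⟨c.1 + 1, hc⟩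
  · have key : ∀ x : Fin k, ¬ c < x := fun x hx => by
      rw [Fin.lt_def] at hx; omega
    simp [key]

theorem rankNumber_comp_swap (τ : MultisetPerm n I) {i j : Fin n} (hij : i < j)
    (hτ : τ.1 i < τ.1 j) (p : Fin n) (q : Fin k) :
    rankNumber (τ.comp (Equiv.swap i j)) p q =
      rankNumber τ p q + if i ≤ p ∧ p < j ∧ τ.1 i < q ∧ q ≤ τ.1 j then 1 else 0 := by
  zify
  rw [rankNumber_eq_sum, rankNumber_eq_sum, ← sub_eq_iff_eq_add']
  push_cast
  rw [← Finset.sum_sub_distrib, Finset.sum_eq_add i j hij.ne]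
  · simp only [MultisetPerm.comp, Equiv.swap_apply_left, Equiv.swap_apply_right]
    simp only [Fin.le_def, Fin.lt_def] at *
    split_ifs <;> omega
  · rintro m - ⟨hi, hj⟩
    simp [MultisetPerm.comp, Equiv.swap_apply_of_ne_of_ne hi hj]
  · simp
  · simp

/-- Take i to be the first position where ω and ψ differ, and j the first later position whose
letter lies in (ω(i), ψ(i)]. Minimality of j leaves room for the unit by which the swap raises some
rank numbers. -/
theorem BruhatLE.exists_swap {ω ψ : MultisetPerm n I} (h : BruhatLE ω ψ) (hne : ω ≠ ψ) :
    ∃ i j, i < j ∧ ω.1 i < ω.1 j ∧ BruhatLE (ω.comp (Equiv.swap i j)) ψ := by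
  have hex : ∃ i, ω.1 i ≠ ψ.1 i := by
    by_contra! hcon
    exact hne (Subtype.ext (funext hcon))
  obtain ⟨i, hi, hmin⟩ := WellFounded.has_min (wellFounded_lt (α := Fin n)) {i | ω.1 i ≠ ψ.1 i} hex
  have hpre : ∀ m < i, ω.1 m = ψ.1 m := fun m hm => by
    by_contra hcon
    exact hmin m hcon hm
  -- Otherwise ω would beat ψ at [i, ω(i)], as the two agree before i.
  have hlt : ω.1 i < ψ.1 i := by
    by_contra! hcon
    have hcon' : ψ.1 i < ω.1 i := lt_of_le_of_ne hcon (Ne.symm hi)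
    have h1 := h i (ω.1 i)
    rw [rankNumber_eq_sum, rankNumber_eq_sum] at h1
    have h2 : (∑ m, ((if m ≤ i ∧ ω.1 i ≤ ψ.1 m then 1 else 0) + if m = i then 1 else 0)) ≤
        ∑ m, if m ≤ i ∧ ω.1 i ≤ ω.1 m then 1 else 0 := by
      refine Finset.sum_le_sum fun m _ => ?_
      rcases lt_trichotomy m i with hm | rfl | hm
      · simp [hpre m hm, hm.ne]
      · simp [hcon']
      · simp [hm.not_ge, hm.ne']
    rw [Finset.sum_add_distrib, Finset.sum_ite_eq' univ i] at h2
    simp only [mem_univ, if_true] at h2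
    omega
  -- Both words have equally many letters in (ω(i), ψ(i)]. They agree before i, and ψ has one such
  -- letter at i where ω has none.
  have hj : ∃ j, i < j ∧ ω.1 i < ω.1 j ∧ ω.1 j ≤ ψ.1 i := by
    by_contra! hcon
    have h1 := (ω.sum_comp_eq fun x => if ω.1 i < x ∧ x ≤ ψ.1 i then 1 else 0).trans
      (ψ.sum_comp_eq fun x => if ω.1 i < x ∧ x ≤ ψ.1 i then 1 else 0).symm
    have h2 : (∑ m, ((if ω.1 i < ω.1 m ∧ ω.1 m ≤ ψ.1 i then 1 else 0) +
        if m = i then 1 else 0)) ≤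
        ∑ m, if ω.1 i < ψ.1 m ∧ ψ.1 m ≤ ψ.1 i then 1 else 0 := by
      refine Finset.sum_le_sum fun m _ => ?_
      rcases lt_trichotomy m i with hm | rfl | hm
      · simp [hpre m hm, hm.ne]
      · simp [hlt]
      · have : ¬ (ω.1 i < ω.1 m ∧ ω.1 m ≤ ψ.1 i) := fun h => (hcon m hm h.1).not_ge h.2
        simp [this, hm.ne']
    rw [Finset.sum_add_distrib, Finset.sum_ite_eq' univ i] at h2
    simp only [mem_univ, if_true] at h2
    omega
  obtain ⟨j, ⟨hij, hωj, hjψ⟩, hjmin⟩ := WellFounded.has_min (wellFounded_lt (α := Fin n))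
    {j | i < j ∧ ω.1 i < ω.1 j ∧ ω.1 j ≤ ψ.1 i} hj
  refine ⟨i, j, hij, hωj, fun p q => ?_⟩
  rw [rankNumber_comp_swap ω hij hωj]
  split_ifs with hpq
  -- Here r_ω[p,q] < r_ψ[p,q] is needed. By minimality of j, letters ≥ q of ω at positions in (i, p]
  -- exceed ψ(i), and the number of letters > ψ(i) is controlled by `h0`. Letters in [q, ψ(i)]
  -- before i are common, and ψ has an extra one at i.
  · obtain ⟨hip, hpj, hq, hqj⟩ := hpq
    have h0 := h.sum_gt_le p (ψ.1 i)
    rw [rankNumber_eq_sum, rankNumber_eq_sum]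
    have h1 : (∑ m, if m ≤ p ∧ q ≤ ω.1 m then 1 else 0) ≤
        ∑ m, ((if m ≤ p ∧ ψ.1 i < ω.1 m then 1 else 0) +
          if m < i ∧ q ≤ ψ.1 m ∧ ψ.1 m ≤ ψ.1 i then 1 else 0) := by
      refine Finset.sum_le_sum fun m _ => ?_
      rcases lt_trichotomy m i with hm | rfl | hm
      · rw [hpre m hm]
        simp only [Fin.le_def, Fin.lt_def] at *
        split_ifs <;> omega
      · simp [hq.not_ge]
      · by_cases hmp : m ≤ p ∧ q ≤ ω.1 m
        · have : ψ.1 i < ω.1 m := by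
            by_contra! hcon
            exact hjmin m ⟨hm, hq.trans_le hmp.2, hcon⟩ (hmp.1.trans_lt hpj)
          simp [hmp, this]
        · simp [hmp]
    have h2 : (∑ m, (((if m ≤ p ∧ ψ.1 i < ψ.1 m then 1 else 0) +
          if m < i ∧ q ≤ ψ.1 m ∧ ψ.1 m ≤ ψ.1 i then 1 else 0) + if m = i then 1 else 0)) ≤
        ∑ m, if m ≤ p ∧ q ≤ ψ.1 m then 1 else 0 := by
      refine Finset.sum_le_sum fun m _ => ?_
      have hqi := hqj.trans hjψ
      rcases eq_or_ne m i with rfl | hm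
      · simp [hip, hqi]
      · simp only [hm, if_false, Fin.le_def, Fin.lt_def] at *
        split_ifs <;> omega
    rw [Finset.sum_add_distrib] at h1 h2
    rw [Finset.sum_add_distrib, Finset.sum_ite_eq' univ i] at h2
    simp only [mem_univ, if_true] at h2
    omega
  · exact h p q

/-- Induction along the Bruhat order, one transposition at a time. -/
theorem BruhatLE.induction {ψ : MultisetPerm n I} {P : MultisetPerm n I → Prop} (base : P ψ)
    (step : ∀ (τ : MultisetPerm n I) (i j : Fin n), i < j → τ.1 i < τ.1 j →
      P (τ.comp (Equiv.swap i j)) → P τ)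
    {ω : MultisetPerm n I} (h : BruhatLE ω ψ) : P ω := by
  induction hN : (∑ p, ∑ q, rankNumber ψ p q) - ∑ p, ∑ q, rankNumber ω p q
    using Nat.strong_induction_on generalizing ω with
  | _ N ih =>
    by_cases hne : ω = ψ
    · exact hne ▸ base
    obtain ⟨i, j, hij, hω, h'⟩ := h.exists_swap hne
    refine step ω i j hij hω (ih _ ?_ h' rfl)
    have hle : ∑ p, ∑ q, rankNumber (ω.comp (Equiv.swap i j)) p q ≤
        ∑ p, ∑ q, rankNumber ψ p q :=
      Finset.sum_le_sum fun p _ => Finset.sum_le_sum fun q _ => h' p q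
    have hmono : ∀ p q, rankNumber ω p q ≤ rankNumber (ω.comp (Equiv.swap i j)) p q :=
      fun p q => by rw [rankNumber_comp_swap ω hij hω]; exact Nat.le_add_right _ _
    -- The swap adds one at p = i, q = ω(j).
    have hlt : ∑ p, ∑ q, rankNumber ω p q <
        ∑ p, ∑ q, rankNumber (ω.comp (Equiv.swap i j)) p q := by
      refine Finset.sum_lt_sum (fun p _ => Finset.sum_le_sum fun q _ => hmono p q)
        ⟨i, mem_univ _, Finset.sum_lt_sum (fun q _ => hmono i q) ⟨ω.1 j, mem_univ _, ?_⟩⟩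
      rw [rankNumber_comp_swap ω hij hω]
      simp [hij, hω]
    omega

end Combinatorics

end FlagBruhat

namespace FlagBruhat

open Finset Matrix Filter Topology

/-! ### LU factorization near the identity and torus contraction. -/

section Triangular

/-- Near the identity every matrix is a product of a lower unitriangular and an invertible upper
triangular matrix. -/
theorem eventually_exists_lower_mul_upper (n : ℕ) :
    ∀ᶠ M in 𝓝 (1 : Matrix (Fin n) (Fin n) ℝ), ∃ L U : Matrix (Fin n) (Fin n) ℝ,
      (∀ i j, i < j → L i j = 0) ∧ (∀ i, L i i = 1) ∧ (∀ i j, j < i → U i j = 0) ∧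
      (∀ i, U i i ≠ 0) ∧ M = L * U := by
  induction n with
  | zero => exact Eventually.of_forall fun M => ⟨1, 1, fun i => i.elim0, fun i => i.elim0,
      fun i => i.elim0, fun i => i.elim0, by ext i; exact i.elim0⟩
  | succ n ih =>
    -- Schur complement of the top left entry; it is continuous at 1 and sends 1 to 1, so the
    -- induction hypothesis applies to it.
    let S : Matrix (Fin (n + 1)) (Fin (n + 1)) ℝ → Matrix (Fin n) (Fin n) ℝ :=
      fun M => of fun i j => M i.succ j.succ - M i.succ 0 * (M 0 0)⁻¹ * M 0 j.succ
    have hent : ∀ i j, ContinuousAt (fun M : Matrix (Fin (n + 1)) (Fin (n + 1)) ℝ => M i j) 1 :=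
      fun i j => (continuous_id.matrix_elem i j).continuousAt
    have hS : Tendsto S (𝓝 1) (𝓝 1) := by
      have h1 : S 1 = 1 := by
        ext i j
        simp [S, Matrix.one_apply]
      have h2 : ContinuousAt S 1 := by
        refine continuousAt_pi.2 fun i => continuousAt_pi.2 fun j => ?_
        exact (hent _ _).sub (((hent _ _).mul ((hent 0 0).inv₀ (by simp))).mul (hent _ _))
      simpa [ContinuousAt, h1] using h2
    have hne : ∀ᶠ M in 𝓝 (1 : Matrix (Fin (n + 1)) (Fin (n + 1)) ℝ), M 0 0 ≠ 0 :=
      (hent 0 0).eventually_ne (by simp)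
    filter_upwards [hS.eventually ih, hne] with M hM h0
    obtain ⟨L, U, hL, hL1, hU, hU0, hLU⟩ := hM
    refine ⟨of fun i j => Fin.cases (Fin.cases 1 (fun _ => 0) j)
        (fun i => Fin.cases (M i.succ 0 * (M 0 0)⁻¹) (fun j => L i j) j) i,
      of fun i j => Fin.cases (M 0 j) (fun i => Fin.cases 0 (fun j => U i j) j) i,
      ?_, ?_, ?_, ?_, ?_⟩
    · intro i j hij
      induction i using Fin.cases <;> induction j using Fin.cases <;> simp_all
    · intro i
      induction i using Fin.cases <;> simp_all
    · intro i j hij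
      induction i using Fin.cases <;> induction j using Fin.cases <;> simp_all
    · intro i
      induction i using Fin.cases <;> simp_all
    · ext i j
      rw [Matrix.mul_apply, Fin.sum_univ_succ]
      induction i using Fin.cases with
      | zero => simp
      | succ i =>
        induction j using Fin.cases with
        | zero => simp [h0]
        | succ j =>
          have := congrFun (congrFun hLU i) j
          rw [Matrix.mul_apply] at this
          simp only [of_apply, Fin.cases_zero, Fin.cases_succ, ← this, S]
          ring

theorem det_eq_prod_of_lower {ι : Type*} [Fintype ι] [LinearOrder ι] {L : Matrix ι ι ℝ}
    (hL : ∀ i j, i < j → L i j = 0) : L.det = ∏ i, L i i :=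
  det_of_isLowerTriangular L fun i j h => hL i j h

theorem det_eq_prod_of_upper {ι : Type*} [Fintype ι] [LinearOrder ι] {U : Matrix ι ι ℝ}
    (hU : ∀ i j, j < i → U i j = 0) : U.det = ∏ i, U i i :=
  det_of_isUpperTriangular fun i j h => hU i j h

/-- The leading minors of a product of a lower and an upper triangular matrix. -/
theorem det_leading_mul {n : ℕ} {L U : Matrix (Fin n) (Fin n) ℝ}
    (hL : ∀ i j, i < j → L i j = 0) (hU : ∀ i j, j < i → U i j = 0) (p : Fin n) :
    ((L * U).submatrix (Subtype.val : {i // i ≤ p} → Fin n) Subtype.val).det =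
      (∏ i : {i // i ≤ p}, L i i) * ∏ i : {i // i ≤ p}, U i i := by
  have h : (L * U).submatrix (Subtype.val : {i // i ≤ p} → Fin n) Subtype.val =
      L.submatrix (Subtype.val : {i // i ≤ p} → Fin n) (Subtype.val : {i // i ≤ p} → Fin n) *
        U.submatrix Subtype.val Subtype.val := by
    ext i j
    simp only [submatrix_apply, Matrix.mul_apply]
    rw [← Finset.sum_subtype (univ.filter fun m => m ≤ p) (by simp) fun m => L i m * U m j]
    refine (Finset.sum_subset (Finset.subset_univ _) fun m _ hm => ?_).symm
    rw [hL i m (i.2.trans_lt (by simpa using hm)), zero_mul]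
  have hLs : (L.submatrix (Subtype.val : {i // i ≤ p} → Fin n) Subtype.val).det =
      ∏ i : {i // i ≤ p}, L i i := det_eq_prod_of_lower fun i j hij => hL i j hij
  have hUs : (U.submatrix (Subtype.val : {i // i ≤ p} → Fin n) Subtype.val).det =
      ∏ i : {i // i ≤ p}, U i i := det_eq_prod_of_upper fun i j hij => hU i j hij
  rw [h, det_mul, hLs, hUs]

/-- The diagonal conjugates of a lower unitriangular matrix, extended to the limit `s = 0`. -/
noncomputable def scaleLower {n : ℕ} (L : Matrix (Fin n) (Fin n) ℝ) (s : ℝ) : Matrix (Fin n) (Fin n) ℝ :=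
  of fun i j => if j ≤ i then s ^ (i.1 - j.1) * L i j else 0

theorem scaleLower_zero {n : ℕ} {L : Matrix (Fin n) (Fin n) ℝ} (hL1 : ∀ i, L i i = 1) :
    scaleLower L 0 = 1 := by
  ext i j
  rcases lt_trichotomy i j with h | rfl | h
  · simp [scaleLower, h.not_ge, h.ne]
  · simp [scaleLower, hL1]
  · have : i.1 - j.1 ≠ 0 := by rw [Fin.lt_def] at h; omega
    simp [scaleLower, h.ne', this]

theorem continuous_scaleLower {n : ℕ} (L : Matrix (Fin n) (Fin n) ℝ) :
    Continuous (scaleLower L) := by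
  refine continuous_matrix fun i j => ?_
  by_cases h : j ≤ i
  · simp only [scaleLower, of_apply, h, if_true]
    fun_prop
  · simp only [scaleLower, of_apply, h, if_false]
    fun_prop

theorem scaleLower_mul_diagonal {n : ℕ} {L : Matrix (Fin n) (Fin n) ℝ}
    (hL : ∀ i j, i < j → L i j = 0) (s : ℝ) :
    scaleLower L s * diagonal (fun i => s ^ i.1) = diagonal (fun i => s ^ i.1) * L := by
  ext i j
  rw [mul_diagonal, diagonal_mul]
  by_cases h : j ≤ i
  · have : s ^ i.1 = s ^ (i.1 - j.1) * s ^ j.1 := by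
      rw [← pow_add, Nat.sub_add_cancel h]
    simp only [scaleLower, of_apply, h, if_true, this]
    ring
  · simp [scaleLower, h, hL i j (not_le.1 h)]

end Triangular

/-! ### Incidence of coordinate flags through the big cell. -/

section Incidence

variable {n k : ℕ} {I : Fin k → ℕ}

/-- Some matrix in the big cell `B_n^- B_n^+` carries the coordinate flag of `ψ` to that of `ω`,
written out as a vanishing condition on its entries. -/
def BigCellIncident (ω ψ : MultisetPerm n I) : Prop :=
  ∃ L U : Matrix (Fin n) (Fin n) ℝ, (∀ i j, i < j → L i j = 0) ∧ (∀ i, L i i = 1) ∧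
    (∀ i j, j < i → U i j = 0) ∧ (∀ i, U i i ≠ 0) ∧ ∀ i j, ψ.1 j < ω.1 i → (L * U) i j = 0

/-- A nonzero Leibniz term of the p-th leading minor is a permutation σ of the positions ≤ p with
ω(σ(i)) ≤ ψ(i), which compares the counts of letters ≥ q. -/
theorem bruhatLE_of_lower_mul_upper {ω ψ : MultisetPerm n I} {L U : Matrix (Fin n) (Fin n) ℝ}
    (hL : ∀ i j, i < j → L i j = 0) (hL0 : ∀ i, L i i ≠ 0)
    (hU : ∀ i j, j < i → U i j = 0) (hU0 : ∀ i, U i i ≠ 0)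
    (h : ∀ i j, ψ.1 j < ω.1 i → (L * U) i j = 0) : BruhatLE ω ψ := by
  intro p q
  have hdet := det_leading_mul hL hU p
  have hne : ((L * U).submatrix (Subtype.val : {i // i ≤ p} → Fin n) Subtype.val).det ≠ 0 := by
    rw [hdet]
    exact mul_ne_zero (Finset.prod_ne_zero_iff.2 fun i _ => hL0 i)
      (Finset.prod_ne_zero_iff.2 fun i _ => hU0 i)
  rw [det_apply] at hne
  obtain ⟨σ, -, hσ⟩ := Finset.exists_ne_zero_of_sum_ne_zero hne
  have hσ' : ∀ i : {i // i ≤ p}, ω.1 (σ i) ≤ ψ.1 i := by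
    intro i
    by_contra! hcon
    refine hσ ?_
    rw [Finset.prod_eq_zero (mem_univ i) (h _ _ hcon), smul_zero]
  have hcard : ∀ τ : MultisetPerm n I,
      rankNumber τ p q = ∑ i : {i // i ≤ p}, if q ≤ τ.1 i then 1 else 0 := by
    intro τ
    rw [rankNumber_eq_sum, ← Finset.sum_subtype (univ.filter fun m => m ≤ p) (by simp)
      fun m => if q ≤ τ.1 m then 1 else 0, Finset.sum_filter]
    exact Finset.sum_congr rfl fun m _ => ite_and _ _ _ _
  rw [hcard, hcard, ← Equiv.sum_comp σ]
  refine Finset.sum_le_sum fun i _ => ?_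
  by_cases hq : q ≤ ω.1 (σ i)
  · simp [hq, hq.trans (hσ' i)]
  · simp [hq]

theorem BigCellIncident.refl (ψ : MultisetPerm n I) : BigCellIncident ψ ψ := by
  refine ⟨1, 1, fun i j h => one_apply_ne h.ne, fun i => one_apply_eq i,
    fun i j h => one_apply_ne h.ne', fun i => by simp, fun i j h => ?_⟩
  rw [mul_one]
  exact one_apply_ne fun hij => h.ne (by rw [hij])

theorem lower_mul {L L' : Matrix (Fin n) (Fin n) ℝ} (hL : ∀ i j, i < j → L i j = 0)
    (hL' : ∀ i j, i < j → L' i j = 0) :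
    (∀ i j, i < j → (L * L') i j = 0) ∧ ∀ i, (L * L') i i = L i i * L' i i := by
  constructor
  · intro i j hij
    rw [Matrix.mul_apply]
    refine Finset.sum_eq_zero fun m _ => ?_
    rcases lt_or_ge i m with hm | hm
    · rw [hL i m hm, zero_mul]
    · rw [hL' m j (hm.trans_lt hij), mul_zero]
  · intro i
    rw [Matrix.mul_apply, Finset.sum_eq_single i]
    · intro m _ hm
      rcases lt_or_gt_of_ne hm with hm | hm
      · rw [hL' m i hm, mul_zero]
      · rw [hL i m hm, zero_mul]
    · simp

theorem upper_mul {U U' : Matrix (Fin n) (Fin n) ℝ} (hU : ∀ i j, j < i → U i j = 0)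
    (hU' : ∀ i j, j < i → U' i j = 0) :
    (∀ i j, j < i → (U * U') i j = 0) ∧ ∀ i, (U * U') i i = U i i * U' i i := by
  have h := lower_mul (L := U'ᵀ) (L' := Uᵀ) (fun i j h => hU' j i h) (fun i j h => hU j i h)
  rw [← transpose_mul] at h
  exact ⟨fun i j hij => h.1 j i hij, fun i => (h.2 i).trans (mul_comm _ _)⟩

/-- With T = 1 + E_ij and T' = 1 − E_ji, the product T'T sends e_j to e_i and e_i to e_i − e_j,
hence carries the flag of the swapped word to that of ω. Let D = diag(s^m) and L_s = DLD⁻¹. For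
small s ≠ 0 the matrix T L_s T⁻¹ is near 1, so it factors as L'U'. Then T'T·D·LU = (T'L')(U'TDU)
lies in the big cell, and D fixes coordinate flags. -/
theorem BigCellIncident.of_comp_swap {ω ψ : MultisetPerm n I} {i j : Fin n} (hij : i < j)
    (hω : ω.1 i < ω.1 j) (h : BigCellIncident (ω.comp (Equiv.swap i j)) ψ) :
    BigCellIncident ω ψ := by
  obtain ⟨L, U, hL, hL1, hU, hU0, hLU⟩ := h
  have hu : transvection i j (1 : ℝ) * transvection i j (-1) = 1 := by
    rw [transvection_mul_transvection_same i j hij.ne]; simp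
  have hu' : transvection i j (-1 : ℝ) * transvection i j 1 = 1 := by
    rw [transvection_mul_transvection_same i j hij.ne]; simp
  have htend : Tendsto (fun s => transvection i j (1 : ℝ) * scaleLower L s *
      transvection i j (-1)) (𝓝[≠] 0) (𝓝 1) := by
    have hc : Continuous fun s => transvection i j (1 : ℝ) * scaleLower L s *
      transvection i j (-1) :=
      (continuous_const.matrix_mul (continuous_scaleLower L)).matrix_mul continuous_const
    have := hc.tendsto 0
    rw [scaleLower_zero hL1, mul_one, hu] at this
    exact this.mono_left nhdsWithin_le_nhds
  obtain ⟨s, ⟨L', U', hL', hL1', hU', hU0', hLU'⟩, hs⟩ :=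
    ((htend.eventually (eventually_exists_lower_mul_upper n)).and
      self_mem_nhdsWithin).exists
  have hs0 : s ≠ 0 := hs
  set D : Matrix (Fin n) (Fin n) ℝ := diagonal fun i => s ^ i.1 with hD
  have hDup : ∀ a b : Fin n, b < a → D a b = 0 := fun a b hab => diagonal_apply_ne _ hab.ne'
  have hTup : ∀ a b : Fin n, b < a → transvection i j (1 : ℝ) a b = 0 := by
    intro a b hab
    have : ¬ (i = a ∧ j = b) := by rintro ⟨rfl, rfl⟩; exact hab.not_gt hij
    simp [transvection, one_apply_ne hab.ne', this]
  have hTlow : ∀ a b : Fin n, a < b → transvection j i (-1 : ℝ) a b = 0 := by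
    intro a b hab
    have : ¬ (j = a ∧ i = b) := by rintro ⟨rfl, rfl⟩; exact hab.not_gt hij
    simp [transvection, one_apply_ne hab.ne, this]
  have hTdiag : ∀ (a : Fin n) (c : ℝ), transvection i j c a a = 1 := by
    intro a c
    have : ¬ (i = a ∧ j = a) := by rintro ⟨rfl, rfl⟩; exact lt_irrefl _ hij
    simp [transvection, this]
  have hTdiag' : ∀ (a : Fin n) (c : ℝ), transvection j i c a a = 1 := by
    intro a c
    have : ¬ (j = a ∧ i = a) := by rintro ⟨rfl, rfl⟩; exact lt_irrefl _ hij
    simp [transvection, this]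
  obtain ⟨h1, h1'⟩ := lower_mul hTlow hL'
  obtain ⟨h2, h2'⟩ := upper_mul hU' hTup
  obtain ⟨h3, h3'⟩ := upper_mul hDup hU
  obtain ⟨h4, h4'⟩ := upper_mul h2 h3
  refine ⟨transvection j i (-1) * L', U' * transvection i j 1 * (D * U), h1, ?_, h4, ?_, ?_⟩
  · intro a
    rw [h1', hTdiag', hL1', one_mul]
  · intro a
    rw [h4', h2', h3', hTdiag, hD, diagonal_apply_eq]
    exact mul_ne_zero (mul_ne_zero (hU0' a) one_ne_zero)
      (mul_ne_zero (pow_ne_zero _ hs0) (hU0 a))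
  · have hprod : transvection j i (-1) * L' * (U' * transvection i j 1 * (D * U)) =
        transvection j i (-1) * transvection i j 1 * (D * (L * U)) := by
      calc _ = transvection j i (-1) * (L' * U') * transvection i j 1 * D * U := by
            simp only [Matrix.mul_assoc]
        _ = transvection j i (-1) * transvection i j 1 *
            (scaleLower L s * (transvection i j (-1) * transvection i j 1) * D) * U := by
            rw [← hLU']; simp only [Matrix.mul_assoc]
        _ = _ := by
            rw [hu', mul_one, scaleLower_mul_diagonal hL, hD]; simp only [Matrix.mul_assoc]
    rw [hprod]
    intro a b hab
    rw [Matrix.mul_apply]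
    refine Finset.sum_eq_zero fun m _ => ?_
    by_cases hm : ψ.1 b < ω.1 (Equiv.swap i j m)
    · rw [hD, diagonal_mul, hLU m b hm, mul_zero, mul_zero]
    -- In the remaining case the entry of T'T vanishes, since T'T carries the flag of the swapped
    -- word to that of ω.
    · have hma : ω.1 (Equiv.swap i j m) < ω.1 a := (not_lt.1 hm).trans_lt hab
      have hG : (transvection j i (-1 : ℝ) * transvection i j (1 : ℝ) :
          Matrix (Fin n) (Fin n) ℝ) a m = 0 := by
        have hval : (transvection j i (-1 : ℝ) * transvection i j (1 : ℝ) :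
            Matrix (Fin n) (Fin n) ℝ) a m = (if a = m then 1 else 0) +
              (if i = a ∧ j = m then 1 else 0) - (if j = a ∧ i = m then 1 else 0) -
              (if j = a ∧ j = m then 1 else 0) := by
          simp only [transvection, add_mul, mul_add, one_mul, mul_one, single_mul_single_same,
            Matrix.add_apply, one_apply, single_apply]
          split_ifs <;> norm_num
        rw [hval]
        rcases eq_or_ne m j with rfl | hmj
        · have hai : i ≠ a := by
            rintro rfl
            rw [Equiv.swap_apply_right] at hma
            exact lt_irrefl _ hma
          rcases eq_or_ne a m with rfl | ham
          · simp [hai]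
          · simp [hai, ham, ham.symm]
        · rcases eq_or_ne m i with rfl | hmi
          · rw [Equiv.swap_apply_left] at hma
            have h1 : a ≠ m := by rintro rfl; exact hma.not_gt hω
            have h2 : j ≠ a := by rintro rfl; exact lt_irrefl _ hma
            simp [h1, h1.symm, h2]
          · rw [Equiv.swap_apply_of_ne_of_ne hmi hmj] at hma
            have h1 : a ≠ m := by rintro rfl; exact lt_irrefl _ hma
            simp [h1, hmi.symm, hmj.symm]
      rw [hG, zero_mul]

theorem BruhatLE.bigCellIncident {ω ψ : MultisetPerm n I} (h : BruhatLE ω ψ) :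
    BigCellIncident ω ψ :=
  BruhatLE.induction (P := fun τ => BigCellIncident τ ψ) (BigCellIncident.refl ψ)
    (fun _ _ _ hij hτ hP => hP.of_comp_swap hij hτ) h

theorem mem_coordFlag (ω : MultisetPerm n I) (l : Fin (k + 1)) (x : EuclideanSpace ℝ (Fin n)) :
    x ∈ (coordFlag ω).V l ↔ ∀ i, ¬ (ω.1 i).castSucc < l → x i = 0 := by
  constructor
  · intro hx i hi
    change x ∈ Submodule.span ℝ _ at hx
    induction hx using Submodule.span_induction with
    | mem y hy =>
      obtain ⟨m, hm, rfl⟩ := hy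
      have : i ≠ m := by rintro rfl; exact hi hm
      simp [this]
    | zero => simp
    | add y z _ _ hy hz => simp [hy, hz]
    | smul c y _ hy => simp [hy]
  · intro hx
    have hsum : x = ∑ i, x i • EuclideanSpace.single i (1 : ℝ) := by
      ext j
      simp [Pi.single_apply]
    rw [hsum]
    refine Submodule.sum_mem _ fun i _ => ?_
    by_cases hi : (ω.1 i).castSucc < l
    · exact Submodule.smul_mem _ _ (Submodule.subset_span ⟨i, hi, rfl⟩)
    · rw [hx i hi, zero_smul]
      exact Submodule.zero_mem _

/-- The vanishing of entries only says that g maps each space into its target; equality follows by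
dimension. -/
theorem act_coordFlag_eq_iff (g : SpecialLinearGroup (Fin n) ℝ) (ψ ω : MultisetPerm n I) :
    (coordFlag ψ).act g = coordFlag ω ↔
      ∀ i j, ψ.1 j < ω.1 i → (g : Matrix (Fin n) (Fin n) ℝ) i j = 0 := by
  constructor
  · intro h i j hij
    have hj : EuclideanSpace.single j (1 : ℝ) ∈ (coordFlag ψ).V (ψ.1 j).succ :=
      Submodule.subset_span ⟨j, by simp, rfl⟩
    have hgj : toEuclideanLin (g : Matrix (Fin n) (Fin n) ℝ) (EuclideanSpace.single j 1) ∈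
        ((coordFlag ψ).act g).V (ψ.1 j).succ := Submodule.mem_map_of_mem hj
    rw [h, mem_coordFlag] at hgj
    have := hgj i (by rw [Fin.castSucc_lt_succ_iff]; exact not_le.2 hij)
    simpa [toLpLin_apply] using this
  · intro h
    ext1
    funext l
    refine Submodule.eq_of_le_of_finrank_eq ?_ ?_
    · rintro _ ⟨x, hx, rfl⟩
      have hx' := (mem_coordFlag ψ l x).1 hx
      rw [mem_coordFlag]
      intro i hi
      simp only [toLpLin_apply, mulVec, dotProduct]
      refine Finset.sum_eq_zero fun j _ => ?_
      by_cases hj : (ψ.1 j).castSucc < l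
      · have : ψ.1 j < ω.1 i := by
          rw [← Fin.castSucc_lt_castSucc_iff]
          exact hj.trans_le (not_lt.1 hi)
        rw [h i j this, zero_mul]
      · rw [hx' j hj, mul_zero]
    · rw [PartialFlag.finrank_eq, PartialFlag.finrank_eq]

theorem PartialFlag.act_mul (g h : SpecialLinearGroup (Fin n) ℝ) (E : PartialFlag n I) :
    E.act (g * h) = (E.act h).act g := by
  ext1
  funext l
  change (E.V l).map _ = ((E.V l).map _).map _
  rw [← Submodule.map_comp]
  congr 1
  ext x i
  simp [toLpLin_apply]

theorem PartialFlag.act_one (E : PartialFlag n I) : E.act 1 = E := by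
  ext1
  funext l
  change (E.V l).map _ = E.V l
  have : toEuclideanLin ((1 : SpecialLinearGroup (Fin n) ℝ) : Matrix (Fin n) (Fin n) ℝ) =
      LinearMap.id := by
    ext x i
    simp
  rw [this, Submodule.map_id]

theorem mem_upperBorel_iff {g : SpecialLinearGroup (Fin n) ℝ} :
    g ∈ upperBorel n ↔ ∀ i j, j < i → (g : Matrix (Fin n) (Fin n) ℝ) i j = 0 :=
  ⟨fun h _ _ hij => h hij, fun h i j hij => h i j hij⟩

theorem mem_lowerBorel_iff {g : SpecialLinearGroup (Fin n) ℝ} :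
    g ∈ lowerBorel n ↔ ∀ i j, i < j → (g : Matrix (Fin n) (Fin n) ℝ) i j = 0 :=
  ⟨fun h _ _ hij => h hij, fun h i j hij => h i j hij⟩

theorem schubertCell_inter_nonempty_iff (ψ ω : MultisetPerm n I) :
    (schubertCell ψ ∩ dualSchubertCell ω).Nonempty ↔ BruhatLE ω ψ := by
  constructor
  · rintro ⟨E, ⟨u, hu, rfl⟩, l, hl, hE⟩
    have hact : (coordFlag ψ).act (l⁻¹ * u) = coordFlag ω := by
      rw [PartialFlag.act_mul, hE, ← PartialFlag.act_mul, inv_mul_cancel, PartialFlag.act_one]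
    rw [act_coordFlag_eq_iff] at hact
    have hl' := mem_lowerBorel_iff.1 (inv_mem hl)
    have hu' := mem_upperBorel_iff.1 hu
    have hdl := (l⁻¹).det_coe
    rw [det_eq_prod_of_lower hl'] at hdl
    have hdu := u.det_coe
    rw [det_eq_prod_of_upper hu'] at hdu
    refine bruhatLE_of_lower_mul_upper hl' (fun i => ?_) hu' (fun i => ?_) (by simpa using hact)
    · exact Finset.prod_ne_zero_iff.1 (hdl.trans_ne one_ne_zero) i (mem_univ i)
    · exact Finset.prod_ne_zero_iff.1 (hdu.trans_ne one_ne_zero) i (mem_univ i)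
  · intro h
    obtain ⟨L, U, hL, hL1, hU, hU0, hLU⟩ := h.bigCellIncident
    have hD : ∀ i j : Fin n, j < i → diagonal (fun i => (U i i)⁻¹) i j = 0 :=
      fun i j hij => diagonal_apply_ne _ hij.ne'
    obtain ⟨h1, h1'⟩ := upper_mul hU hD
    let l : SpecialLinearGroup (Fin n) ℝ := ⟨L, by rw [det_eq_prod_of_lower hL]; simp [hL1]⟩
    -- Rescaling columns gives determinant one and keeps the vanishing entries.
    let u : SpecialLinearGroup (Fin n) ℝ := ⟨U * diagonal fun i => (U i i)⁻¹, by
      rw [det_eq_prod_of_upper h1]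
      exact Finset.prod_eq_one fun i _ => by rw [h1', diagonal_apply_eq, mul_inv_cancel₀ (hU0 i)]⟩
    have hl : l ∈ lowerBorel n := mem_lowerBorel_iff.2 hL
    have hu : u ∈ upperBorel n := mem_upperBorel_iff.2 h1
    have hact : (coordFlag ψ).act (l * u) = coordFlag ω := by
      rw [act_coordFlag_eq_iff]
      intro i j hij
      change (L * (U * diagonal fun i => (U i i)⁻¹) : Matrix (Fin n) (Fin n) ℝ) i j = 0
      rw [← Matrix.mul_assoc, mul_diagonal, hLU i j hij, zero_mul]
    refine ⟨(coordFlag ψ).act u, ⟨u, hu, rfl⟩, l⁻¹, inv_mem hl, ?_⟩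
    rw [← hact, ← PartialFlag.act_mul, inv_mul_cancel_left]

end Incidence

end FlagBruhat

namespace FlagBruhat

open Matrix ContinuousLinearMap

/-! ### Smoothness and derivative of the projection onto a moving subspace. -/

section Projections

variable {F : Type*} [NormedAddCommGroup F] [InnerProductSpace ℝ F] [FiniteDimensional ℝ F]

/-- The positive operator whose inverse enters the projection onto `M(V)`. -/
noncomputable def gramOperator (V : Submodule ℝ F) (M : F →L[ℝ] F) : F →L[ℝ] F :=
  star (M * V.starProjection) * (M * V.starProjection) + (1 - V.starProjection)

/-- With P the projection and S the operator, ⟨Sx, x⟩ = ‖MPx‖² + ‖x − Px‖², which vanishes only at x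
= 0. -/
theorem isUnit_gramOperator (V : Submodule ℝ F) {M : F →L[ℝ] F} (hM : Function.Injective M) :
    IsUnit (gramOperator V M) := by
  have hinj : Function.Injective (gramOperator V M) := by
    rw [injective_iff_map_eq_zero]
    intro x hx
    have hP : inner ℝ (x - V.starProjection x) (V.starProjection x) = 0 :=
      V.starProjection_inner_eq_zero x _ (V.starProjection_apply_mem x)
    have h1 : inner ℝ (gramOperator V M x) x =
        ‖M (V.starProjection x)‖ ^ 2 + ‖x - V.starProjection x‖ ^ 2 := by
      have hx' : inner ℝ (x - V.starProjection x) x = ‖x - V.starProjection x‖ ^ 2 := by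
        rw [← real_inner_self_eq_norm_sq]
        conv_rhs => rw [inner_sub_right, hP, sub_zero]
      simp only [gramOperator, _root_.add_apply, _root_.sub_apply,
        inner_add_left, mul_apply_eq_comp, star_eq_adjoint, one_apply_eq_self, hx']
      rw [adjoint_inner_left, mul_apply_eq_comp, real_inner_self_eq_norm_sq]
    rw [hx, inner_zero_left] at h1
    have h5 := sq_nonneg (‖M (V.starProjection x)‖)
    have h6 := sq_nonneg (‖x - V.starProjection x‖)
    have h2 : ‖M (V.starProjection x)‖ = 0 := pow_eq_zero_iff two_ne_zero |>.1 (by linarith)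
    have h3 : ‖x - V.starProjection x‖ = 0 := pow_eq_zero_iff two_ne_zero |>.1 (by linarith)
    have h4 : V.starProjection x = 0 := hM (by rw [norm_eq_zero.1 h2, map_zero])
    rw [h4, sub_zero] at h3
    exact norm_eq_zero.1 h3
  rw [ContinuousLinearMap.isUnit_iff_bijective]
  exact ⟨hinj, LinearMap.surjective_of_injective (f := (gramOperator V M : F →ₗ[ℝ] F)) hinj⟩

/-- Least squares: with N = MP one has SP = N*N, so Q = N S⁻¹ N* is self-adjoint with QN = N. The
formula makes smoothness in M visible. -/
theorem starProjection_map (V : Submodule ℝ F) {M : F →L[ℝ] F} (hM : Function.Injective M) :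
    (V.map (M : F →ₗ[ℝ] F)).starProjection =
      M * V.starProjection * Ring.inverse (gramOperator V M) * star (M * V.starProjection) := by
  set P := V.starProjection with hP
  set S := gramOperator V M with hS
  set N := M * P with hN
  have hPP : P * P = P := V.isIdempotentElem_starProjection
  have hPs : star P = P := isSelfAdjoint_starProjection V
  have hNP : N * P = N := by rw [hN, mul_assoc, hPP]
  have hSP : S * P = star N * N := by
    rw [hS, gramOperator, ← hP, ← hN, add_mul, sub_mul, one_mul, hPP, sub_self, add_zero,
      mul_assoc, hNP]
  have hSu := isUnit_gramOperator V hM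
  rw [← hS] at hSu
  have hSs : star S = S := by
    rw [hS, gramOperator, ← hP, ← hN]
    simp [hPs]
  have hTs : star (Ring.inverse S) = Ring.inverse S := by
    rw [← Ring.inverse_star, hSs]
  have hQs : star (N * Ring.inverse S * star N) = N * Ring.inverse S * star N := by
    simp only [star_mul, star_star, hTs, mul_assoc]
  have hQN : N * Ring.inverse S * star N * N = N := by
    rw [mul_assoc, ← hSP, mul_assoc, ← mul_assoc _ S, Ring.inverse_mul_cancel _ hSu, one_mul, hNP]
  have hNQ : star N * (N * Ring.inverse S * star N) = star N := by
    conv_rhs => rw [← hQN, star_mul, hQs]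
  ext x
  refine Submodule.eq_starProjection_of_mem_of_inner_eq_zero ?_ ?_
  · exact Submodule.mem_map_of_mem (V.starProjection_apply_mem _)
  · rintro _ ⟨w, hw, rfl⟩
    have hw' : M w = N w := by
      rw [hN, mul_apply_eq_comp, hP, Submodule.starProjection_eq_self_iff.2 hw]
    change inner ℝ _ (M w) = 0
    rw [hw', ← adjoint_inner_left, ← star_eq_adjoint, map_sub, ← mul_apply_eq_comp,
      hNQ, sub_self, inner_zero_left]

theorem contDiff_starProjection_map (V : Submodule ℝ F) {M : ℝ → F →L[ℝ] F}
    (hM : ∀ t, Function.Injective (M t)) {r : WithTop ℕ∞} (hsm : ContDiff ℝ r M) :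
    ContDiff ℝ r fun t => (V.map (M t : F →ₗ[ℝ] F)).starProjection := by
  have h1 : ContDiff ℝ r fun t => M t * V.starProjection := hsm.mul contDiff_const
  have h2 : ContDiff ℝ r fun t => star (M t * V.starProjection) :=
    (starL' ℝ : (F →L[ℝ] F) ≃L[ℝ] (F →L[ℝ] F)).contDiff.comp h1
  have h3 : ContDiff ℝ r fun t => gramOperator V (M t) := (h2.mul h1).add contDiff_const
  have h4 : ContDiff ℝ r fun t => Ring.inverse (gramOperator V (M t)) := by
    rw [contDiff_iff_contDiffAt]
    intro t
    obtain ⟨u, hu⟩ := isUnit_gramOperator V (hM t)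
    have := contDiffAt_ringInverse ℝ (n := r) u
    rw [hu] at this
    exact this.comp t h3.contDiffAt
  simp only [fun t => starProjection_map V (hM t)]
  exact (h1.mul h4).mul h2

/-- The infinitesimal action of `A` on the orthogonal projection `P`. -/
noncomputable def infinitesimalAction (P A : F →L[ℝ] F) : F →L[ℝ] F :=
  (1 - P) * A * P + star ((1 - P) * A * P)

theorem infinitesimalAction_add (P A B : F →L[ℝ] F) :
    infinitesimalAction P (A + B) = infinitesimalAction P A + infinitesimalAction P B := by
  simp only [infinitesimalAction, mul_add, add_mul, star_add]
  abel

theorem infinitesimalAction_sub_smul_one {P : F →L[ℝ] F} (hP : P * P = P) (A : F →L[ℝ] F)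
    (c : ℝ) : infinitesimalAction P (A - c • 1) = infinitesimalAction P A := by
  have : (1 - P) * (A - c • 1) * P = (1 - P) * A * P := by
    have h : (1 - P) * P = 0 := by rw [sub_mul, one_mul, hP, sub_self]
    rw [mul_sub, sub_mul, mul_smul_comm, mul_one, smul_mul_assoc, h, smul_zero, sub_zero]
  rw [infinitesimalAction, this, infinitesimalAction]

/-- The relations satisfied by the velocity of a curve of orthogonal projections. -/
theorem deriv_starProjection {W : ℝ → Submodule ℝ F} {v : F →L[ℝ] F}
    (hv : HasDerivAt (fun t => (W t).starProjection) v 0) :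
    star v = v ∧ v * (W 0).starProjection + (W 0).starProjection * v = v := by
  constructor
  · have h := (starL' ℝ : (F →L[ℝ] F) ≃L[ℝ] (F →L[ℝ] F)).hasFDerivAt.comp_hasDerivAt (0 : ℝ) hv
    refine h.unique (hv.congr_of_eventuallyEq (Filter.Eventually.of_forall fun t => ?_))
    exact isSelfAdjoint_starProjection (W t)
  · have h := hv.mul hv
    refine h.unique (hv.congr_of_eventuallyEq (Filter.Eventually.of_forall fun t => ?_))
    exact (W t).isIdempotentElem_starProjection

/-- The derivative v exists by smoothness and is then forced. Differentiating P_t M_t P = M_t P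
gives vP = (1 − P)AP, and v = vP + Pv with v self-adjoint gives v = vP + (vP)*. -/
theorem hasDerivAt_starProjection_map (V : Submodule ℝ F) {M : ℝ → F →L[ℝ] F}
    (hM : ∀ t, Function.Injective (M t)) (hsm : ContDiff ℝ 1 M) (h0 : M 0 = 1) {A : F →L[ℝ] F}
    (hA : HasDerivAt M A 0) :
    HasDerivAt (fun t => (V.map (M t : F →ₗ[ℝ] F)).starProjection)
      (infinitesimalAction V.starProjection A) 0 := by
  have hd := ((contDiff_starProjection_map V hM hsm).differentiable one_ne_zero 0).hasDerivAt
  obtain ⟨hs, hp⟩ := deriv_starProjection hd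
  have hW0 : V.map (M 0 : F →ₗ[ℝ] F) = V := by
    rw [h0]; exact Submodule.map_id V
  have hP0 : (V.map (M 0 : F →ₗ[ℝ] F)).starProjection = V.starProjection := by
    simp only [hW0]
  rw [hP0] at hp
  suffices key : infinitesimalAction V.starProjection A =
      deriv (fun t => (V.map (M t : F →ₗ[ℝ] F)).starProjection) 0 by
    rw [key]
    exact hd
  set v := deriv (fun t => (V.map (M t : F →ₗ[ℝ] F)).starProjection) 0
  set P := V.starProjection with hP
  have hPs : star P = P := isSelfAdjoint_starProjection V
  have h1 := hd.mul (hA.mul_const P)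
  have h2 : v * P + P * (A * P) = A * P := by
    have h3 : HasDerivAt ((fun t => (V.map (M t : F →ₗ[ℝ] F)).starProjection) *
        fun t => M t * P) (A * P) 0 := by
      refine (hA.mul_const P).congr_of_eventuallyEq (Filter.Eventually.of_forall fun t => ?_)
      ext x
      exact Submodule.starProjection_eq_self_iff.2
        (Submodule.mem_map_of_mem (V.starProjection_apply_mem x))
    have := h1.unique h3
    rwa [hP0, h0, one_mul] at this
  have h4 : (1 - P) * A * P = v * P := by
    rw [mul_assoc, sub_mul, one_mul]
    exact (eq_sub_of_add_eq h2).symm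
  change (1 - P) * A * P + star ((1 - P) * A * P) = v
  rw [h4, star_mul, hs, hPs, hp]

end Projections

end FlagBruhat

namespace FlagBruhat

open Matrix ContinuousLinearMap

/-! ### Tangent vectors of flags and transversality. -/

section Tangent

variable {n k : ℕ} {I : Fin k → ℕ}

theorem toEuclideanCLM_eq_sum (M : Matrix (Fin n) (Fin n) ℝ) :
    toEuclideanCLM (𝕜 := ℝ) M =
      ∑ i, ∑ j, M i j • toEuclideanCLM (𝕜 := ℝ) (Matrix.single i j (1 : ℝ)) := by
  conv_lhs => rw [matrix_eq_sum_single M]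
  simp only [map_sum, ← map_smul, smul_single, smul_eq_mul, mul_one]

theorem contDiff_toEuclideanCLM {r : WithTop ℕ∞} {g : ℝ → Matrix (Fin n) (Fin n) ℝ}
    (hg : ∀ i j, ContDiff ℝ r fun t => g t i j) :
    ContDiff ℝ r fun t => toEuclideanCLM (𝕜 := ℝ) (g t) := by
  simp only [toEuclideanCLM_eq_sum (g _)]
  exact ContDiff.sum fun i _ => ContDiff.sum fun j _ => (hg i j).smul contDiff_const

theorem hasDerivAt_toEuclideanCLM {g : ℝ → Matrix (Fin n) (Fin n) ℝ}
    {A : Matrix (Fin n) (Fin n) ℝ} (hg : ∀ i j, HasDerivAt (fun t => g t i j) (A i j) 0) :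
    HasDerivAt (fun t => toEuclideanCLM (𝕜 := ℝ) (g t)) (toEuclideanCLM (𝕜 := ℝ) A) 0 := by
  simp only [toEuclideanCLM_eq_sum (g _), toEuclideanCLM_eq_sum A]
  exact HasDerivAt.fun_sum fun i _ => HasDerivAt.fun_sum fun j _ =>
    (hg i j).smul_const (toEuclideanCLM (𝕜 := ℝ) (Matrix.single i j (1 : ℝ)))

/-- `g` is a smooth curve in `SL(n, ℝ)` through the identity with velocity `A` there. -/
structure IsCurveWithVelocity (g : ℝ → SpecialLinearGroup (Fin n) ℝ)
    (A : EuclideanSpace ℝ (Fin n) →L[ℝ] EuclideanSpace ℝ (Fin n)) : Prop where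
  zero : g 0 = 1
  contDiff : ContDiff ℝ ((⊤ : ℕ∞) : WithTop ℕ∞)
    fun t => toEuclideanCLM (𝕜 := ℝ) (g t : Matrix (Fin n) (Fin n) ℝ)
  hasDerivAt : HasDerivAt
    (fun t => toEuclideanCLM (𝕜 := ℝ) (g t : Matrix (Fin n) (Fin n) ℝ)) A 0

theorem IsCurveWithVelocity.toEuclideanCLM_zero {g : ℝ → SpecialLinearGroup (Fin n) ℝ}
    {A : EuclideanSpace ℝ (Fin n) →L[ℝ] EuclideanSpace ℝ (Fin n)}
    (hg : IsCurveWithVelocity g A) :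
    toEuclideanCLM (𝕜 := ℝ) (g 0 : Matrix (Fin n) (Fin n) ℝ) = 1 := by
  rw [hg.zero]
  exact map_one _

theorem IsCurveWithVelocity.mul {g h : ℝ → SpecialLinearGroup (Fin n) ℝ}
    {A B : EuclideanSpace ℝ (Fin n) →L[ℝ] EuclideanSpace ℝ (Fin n)}
    (hg : IsCurveWithVelocity g A) (hh : IsCurveWithVelocity h B) :
    IsCurveWithVelocity (fun t => g t * h t) (A + B) where
  zero := by simp [hg.zero, hh.zero]
  contDiff := by
    have h1 := hg.contDiff.mul hh.contDiff
    simp only [← map_mul] at h1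
    exact h1
  hasDerivAt := by
    have h1 := hg.hasDerivAt.mul hh.hasDerivAt
    rw [hg.toEuclideanCLM_zero, hh.toEuclideanCLM_zero, mul_one, one_mul] at h1
    refine h1.congr_of_eventuallyEq (Filter.Eventually.of_forall fun t => ?_)
    exact map_mul _ _ _

/-- The tangent vector at the flag `E` generated by the endomorphism `A`. -/
noncomputable def PartialFlag.velocity (E : PartialFlag n I)
    (A : EuclideanSpace ℝ (Fin n) →L[ℝ] EuclideanSpace ℝ (Fin n)) :
    Fin (k + 1) → (EuclideanSpace ℝ (Fin n) →L[ℝ] EuclideanSpace ℝ (Fin n)) :=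
  fun l => infinitesimalAction (E.V l).starProjection A

theorem PartialFlag.velocity_add (E : PartialFlag n I)
    (A B : EuclideanSpace ℝ (Fin n) →L[ℝ] EuclideanSpace ℝ (Fin n)) :
    E.velocity (A + B) = E.velocity A + E.velocity B :=
  funext fun _ => infinitesimalAction_add _ _ _

theorem PartialFlag.velocity_sub_smul_one (E : PartialFlag n I)
    (A : EuclideanSpace ℝ (Fin n) →L[ℝ] EuclideanSpace ℝ (Fin n)) (c : ℝ) :
    E.velocity (A - c • 1) = E.velocity A :=
  funext fun l => infinitesimalAction_sub_smul_one (E.V l).isIdempotentElem_starProjection _ _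

theorem IsCurveWithVelocity.velocity_mem {g : ℝ → SpecialLinearGroup (Fin n) ℝ}
    {A : EuclideanSpace ℝ (Fin n) →L[ℝ] EuclideanSpace ℝ (Fin n)}
    (hg : IsCurveWithVelocity g A) {E : PartialFlag n I} {X : Set (PartialFlag n I)}
    (hX : ∀ t, E.act (g t) ∈ X) : E.velocity A ∈ tangentVectors X E := by
  have hinj : ∀ t, Function.Injective
      (toEuclideanCLM (𝕜 := ℝ) (g t : Matrix (Fin n) (Fin n) ℝ)) :=
    fun t => toEuclideanLin_injective (g t)
  refine ⟨fun t => E.act (g t), (congrArg (fun b => E.act b) hg.zero).trans E.act_one, hX, ?_, ?_⟩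
  · rw [contDiff_pi]
    intro l
    exact contDiff_starProjection_map (E.V l) hinj hg.contDiff
  · rw [hasDerivAt_pi]
    intro l
    exact hasDerivAt_starProjection_map (E.V l) hinj (hg.contDiff.of_le (by exact_mod_cast le_top))
      hg.toEuclideanCLM_zero hg.hasDerivAt

theorem PartialFlag.V_zero (E : PartialFlag n I) : E.V 0 = ⊥ := by
  rw [← Submodule.finrank_eq_zero (R := ℝ), E.finrank_eq]
  simp

theorem PartialFlag.starProjection_mul (E : PartialFlag n I) {l m : Fin (k + 1)} (h : l ≤ m) :
    (E.V l).starProjection * (E.V m).starProjection = (E.V l).starProjection ∧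
    (E.V m).starProjection * (E.V l).starProjection = (E.V l).starProjection := by
  have h1 : (E.V m).starProjection * (E.V l).starProjection = (E.V l).starProjection := by
    ext1 x
    exact Submodule.starProjection_eq_self_iff.2 (E.mono h (Submodule.starProjection_apply_mem _ x))
  refine ⟨?_, h1⟩
  have h2 := congrArg star h1
  rwa [star_mul, isSelfAdjoint_starProjection (E.V m), isSelfAdjoint_starProjection (E.V l)] at h2

/-- Every tangent vector of the flag manifold is generated by an endomorphism. -/
theorem exists_eq_velocity {X : Set (PartialFlag n I)} {E : PartialFlag n I}
    {v : Fin (k + 1) → (EuclideanSpace ℝ (Fin n) →L[ℝ] EuclideanSpace ℝ (Fin n))}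
    (hv : v ∈ tangentVectors X E) : ∃ A, v = E.velocity A := by
  obtain ⟨γ, rfl, -, -, hγ⟩ := hv
  set P : Fin (k + 1) → (EuclideanSpace ℝ (Fin n) →L[ℝ] EuclideanSpace ℝ (Fin n)) :=
    fun l => ((γ 0).V l).starProjection with hP
  have hvl : ∀ l, HasDerivAt (fun t => ((γ t).V l).starProjection) (v l) 0 := hasDerivAt_pi.1 hγ
  have hs : ∀ l, star (v l) = v l := fun l => (deriv_starProjection (hvl l)).1
  have hPs : ∀ l, star (P l) = P l := fun l => isSelfAdjoint_starProjection _
  have hPP : ∀ l m, l ≤ m → P m * P l = P l := fun l m h => ((γ 0).starProjection_mul h).2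
  have hP0 : P 0 = 0 := by
    simp only [hP, (γ 0).V_zero]
    exact Submodule.starProjection_bot
  -- Derivative of the nesting relation P_m P_l = P_l.
  have hrel : ∀ l m, l ≤ m → v m * P l + P m * v l = v l := by
    intro l m h
    refine ((hvl m).mul (hvl l)).unique ((hvl l).congr_of_eventuallyEq ?_)
    exact Filter.Eventually.of_forall fun t => ((γ t).starProjection_mul h).2
  have hkey : ∀ l m, l ≤ m → (1 - P m) * v l = v m * P l := by
    intro l m h
    rw [sub_mul, one_mul]
    exact (eq_sub_of_add_eq (hrel l m h)).symm
  let B : Fin k → (EuclideanSpace ℝ (Fin n) →L[ℝ] EuclideanSpace ℝ (Fin n)) :=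
    fun j => P j.succ - P j.castSucc
  have hBlow : ∀ (j : Fin k) l, j.castSucc < l → B j * P l = B j := by
    intro j l h
    have h1 : j.succ ≤ l := Fin.castSucc_lt_iff_succ_le.1 h
    simp only [B, sub_mul]
    rw [((γ 0).starProjection_mul h1).1, ((γ 0).starProjection_mul h.le).1]
  have hBhigh : ∀ (j : Fin k) l, l ≤ j.castSucc → B j * P l = 0 := by
    intro j l h
    simp only [B, sub_mul]
    rw [hPP _ _ h, hPP _ _ (h.trans (Fin.castSucc_le_succ j)), sub_self]
  have hsum : ∀ l, ∑ j, B j * P l = P l := by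
    intro l
    have htel : ∑ j, B j = P (Fin.last k) := by
      have := Fin.sum_univ_succ P
      have h2 := Fin.sum_univ_castSucc P
      simp only [B, Finset.sum_sub_distrib]
      rw [this, hP0, zero_add] at h2
      rw [h2]
      abel
    rw [← Finset.sum_mul, htel, hPP _ _ (Fin.le_last l)]
  -- On the j-th graded piece, the image of `B j`, the endomorphism acts as the velocity of the
  -- smallest member containing it; `hkey` makes these choices compatible with every larger member.
  let A := ∑ j, v j.succ * B j
  have hA : ∀ l, (1 - P l) * A * P l = v l * P l := by
    intro l
    have hterm : ∀ j, (1 - P l) * (v j.succ * B j) * P l = v l * (B j * P l) := by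
      intro j
      rcases lt_or_ge j.castSucc l with h | h
      · have h1 : j.succ ≤ l := Fin.castSucc_lt_iff_succ_le.1 h
        have h2 : P j.succ * B j = B j := by
          simp only [B, mul_sub]
          rw [hPP _ _ le_rfl, hPP _ _ (Fin.castSucc_le_succ j)]
        rw [← mul_assoc, hkey _ _ h1, mul_assoc (v l), h2, mul_assoc]
      · rw [← mul_assoc, mul_assoc, hBhigh j l h, mul_zero, mul_zero]
    simp only [A, Finset.mul_sum, Finset.sum_mul, hterm]
    rw [← Finset.mul_sum, hsum]
  refine ⟨A, funext fun l => ?_⟩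
  change v l = (1 - P l) * A * P l + star ((1 - P l) * A * P l)
  rw [hA, star_mul, hs, hPs, hrel l l le_rfl]

/-- A curve of upper triangular matrices with prescribed velocity. -/
noncomputable def upperCurve (a : Matrix (Fin n) (Fin n) ℝ) (ha : ∑ i, a i i = 0) (t : ℝ) :
    SpecialLinearGroup (Fin n) ℝ :=
  ⟨of fun i j => if i = j then Real.exp (t * a i i) else if i < j then t * a i j else 0, by
    rw [det_eq_prod_of_upper]
    · simp only [of_apply, if_true]
      rw [← Real.exp_sum, ← Finset.mul_sum, ha, mul_zero, Real.exp_zero]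
    · intro i j h
      simp [h.ne', h.not_gt]⟩

/-- A curve of lower unitriangular matrices with prescribed velocity. -/
noncomputable def lowerCurve (a : Matrix (Fin n) (Fin n) ℝ) (t : ℝ) :
    SpecialLinearGroup (Fin n) ℝ :=
  ⟨of fun i j => if i = j then 1 else if j < i then t * a i j else 0, by
    rw [det_eq_prod_of_lower]
    · simp
    · intro i j h
      simp [h.ne, h.not_gt]⟩

theorem upperCurve_mem (a : Matrix (Fin n) (Fin n) ℝ) (ha : ∑ i, a i i = 0) (t : ℝ) :
    upperCurve a ha t ∈ upperBorel n :=
  mem_upperBorel_iff.2 fun i j h => by simp [upperCurve, h.ne', h.not_gt]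

theorem lowerCurve_mem (a : Matrix (Fin n) (Fin n) ℝ) (t : ℝ) :
    lowerCurve a t ∈ lowerBorel n :=
  mem_lowerBorel_iff.2 fun i j h => by simp [lowerCurve, h.ne, h.not_gt]

theorem isCurveWithVelocity_upperCurve (a : Matrix (Fin n) (Fin n) ℝ) (ha : ∑ i, a i i = 0) :
    IsCurveWithVelocity (upperCurve a ha)
      (toEuclideanCLM (𝕜 := ℝ) (of fun i j => if i ≤ j then a i j else 0)) where
  zero := by
    ext i j
    simp [upperCurve, Matrix.one_apply]
  contDiff := by
    refine contDiff_toEuclideanCLM fun i j => ?_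
    rcases lt_trichotomy i j with h | rfl | h
    · simp only [upperCurve, of_apply, h, h.ne, if_true, if_false]
      fun_prop
    · simp only [upperCurve, of_apply, if_true]
      fun_prop
    · simp only [upperCurve, of_apply, h.not_gt, h.ne', if_false]
      fun_prop
  hasDerivAt := by
    refine hasDerivAt_toEuclideanCLM fun i j => ?_
    rcases lt_trichotomy i j with h | rfl | h
    · simp only [upperCurve, of_apply, h, h.ne, h.le, if_true, if_false]
      exact hasDerivAt_mul_const _
    · simp only [upperCurve, of_apply, le_refl, if_true]
      simpa using (hasDerivAt_mul_const (x := (0 : ℝ)) (a i i)).exp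
    · simp only [upperCurve, of_apply, h.not_gt, h.not_ge, h.ne', if_false]
      exact hasDerivAt_const _ _

theorem isCurveWithVelocity_lowerCurve (a : Matrix (Fin n) (Fin n) ℝ) :
    IsCurveWithVelocity (lowerCurve a)
      (toEuclideanCLM (𝕜 := ℝ) (of fun i j => if i ≤ j then 0 else a i j)) where
  zero := by
    ext i j
    simp [lowerCurve, Matrix.one_apply]
  contDiff := by
    refine contDiff_toEuclideanCLM fun i j => ?_
    rcases lt_trichotomy i j with h | rfl | h
    · simp only [lowerCurve, of_apply, h.not_gt, h.ne, if_false]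
      fun_prop
    · simp only [lowerCurve, of_apply, if_true]
      fun_prop
    · simp only [lowerCurve, of_apply, h, h.ne', if_true, if_false]
      fun_prop
  hasDerivAt := by
    refine hasDerivAt_toEuclideanCLM fun i j => ?_
    rcases lt_trichotomy i j with h | rfl | h
    · simp only [lowerCurve, of_apply, h.not_gt, h.le, h.ne, if_true, if_false]
      exact hasDerivAt_const _ _
    · simp only [lowerCurve, of_apply, le_refl, if_true]
      exact hasDerivAt_const _ _
    · simp only [lowerCurve, of_apply, h, h.not_ge, h.ne', if_true, if_false]
      exact hasDerivAt_mul_const _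

/-- Up to scalars, every endomorphism is the sum of the velocities of a curve of upper and a curve
of lower triangular matrices. -/
theorem exists_triangular_curves
    (A : EuclideanSpace ℝ (Fin n) →L[ℝ] EuclideanSpace ℝ (Fin n)) :
    ∃ (u l : ℝ → SpecialLinearGroup (Fin n) ℝ)
      (B C : EuclideanSpace ℝ (Fin n) →L[ℝ] EuclideanSpace ℝ (Fin n)) (c : ℝ),
      IsCurveWithVelocity u B ∧ IsCurveWithVelocity l C ∧ (∀ t, u t ∈ upperBorel n) ∧
      (∀ t, l t ∈ lowerBorel n) ∧ A - c • 1 = B + C := by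
  set a : Matrix (Fin n) (Fin n) ℝ := (toEuclideanCLM (𝕜 := ℝ)).symm A with ha
  set c : ℝ := a.trace / n with hc
  -- For n = 0 the sum is empty and the value of c is immaterial.
  have htr : ∑ i, (a - c • 1 : Matrix (Fin n) (Fin n) ℝ) i i = 0 := by
    rcases Nat.eq_zero_or_pos n with rfl | hn
    · simp
    · change (a - c • 1).trace = 0
      have : (n : ℝ) ≠ 0 := by positivity
      rw [trace_sub, trace_smul, trace_one, Fintype.card_fin, smul_eq_mul, hc,
        div_mul_cancel₀ _ this, sub_self]
  refine ⟨_, _, _, _, c, isCurveWithVelocity_upperCurve _ htr,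
    isCurveWithVelocity_lowerCurve (a - c • 1), upperCurve_mem _ htr, lowerCurve_mem _, ?_⟩
  rw [← map_add]
  have hsplit : ((of fun i j => if i ≤ j then (a - c • 1) i j else 0) +
      of fun i j => if i ≤ j then 0 else (a - c • 1) i j : Matrix (Fin n) (Fin n) ℝ) =
      a - c • 1 := by
    ext i j
    by_cases h : i ≤ j <;> simp [h]
  rw [hsplit, map_sub, map_smul, map_one, ha, StarAlgEquiv.apply_symm_apply]

theorem act_mem_schubertCell {ψ : MultisetPerm n I} {E : PartialFlag n I}
    (hE : E ∈ schubertCell ψ) {b : SpecialLinearGroup (Fin n) ℝ} (hb : b ∈ upperBorel n) :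
    E.act b ∈ schubertCell ψ := by
  obtain ⟨b', hb', rfl⟩ := hE
  exact ⟨b * b', mul_mem hb hb', (PartialFlag.act_mul _ _ _).symm⟩

theorem act_mem_dualSchubertCell {ω : MultisetPerm n I} {E : PartialFlag n I}
    (hE : E ∈ dualSchubertCell ω) {b : SpecialLinearGroup (Fin n) ℝ} (hb : b ∈ lowerBorel n) :
    E.act b ∈ dualSchubertCell ω := by
  obtain ⟨b', hb', rfl⟩ := hE
  exact ⟨b * b', mul_mem hb hb', (PartialFlag.act_mul _ _ _).symm⟩

theorem intersectTransversally (ψ ω : MultisetPerm n I) :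
    IntersectTransversally (schubertCell ψ) (dualSchubertCell ω) := by
  rintro E ⟨hψ, hω⟩
  ext v
  constructor
  -- Velocities of curves are not closed under addition by definition, so the sum is realized by a
  -- product of triangular curves.
  · rintro ⟨x, hx, y, hy, rfl⟩
    obtain ⟨A₁, rfl⟩ := exists_eq_velocity hx
    obtain ⟨A₂, rfl⟩ := exists_eq_velocity hy
    obtain ⟨u, l, B, C, c, hu, hl, -, -, hsum⟩ := exists_triangular_curves (A₁ + A₂)
    rw [← E.velocity_add, ← E.velocity_sub_smul_one _ c, hsum]
    exact (hu.mul hl).velocity_mem fun t => Set.mem_univ _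
  · intro hv
    obtain ⟨A, rfl⟩ := exists_eq_velocity hv
    obtain ⟨u, l, B, C, c, hu, hl, hum, hlm, hsum⟩ := exists_triangular_curves A
    refine ⟨_, hu.velocity_mem fun t => act_mem_schubertCell hψ (hum t),
      _, hl.velocity_mem fun t => act_mem_dualSchubertCell hω (hlm t), ?_⟩
    rw [← E.velocity_add, ← hsum, E.velocity_sub_smul_one]

end Tangent

end FlagBruhat

theorem mainTheorem6 {n k : ℕ} (I : Fin k → ℕ) (hI : ∀ j, 0 < I j) (hn : ∑ j, I j = n)
    (ψ ω : FlagBruhat.MultisetPerm n I) :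
    ((FlagBruhat.schubertCell ψ ∩ FlagBruhat.dualSchubertCell ω).Nonempty ↔
        FlagBruhat.BruhatLE ω ψ) ∧
      ((FlagBruhat.schubertCell ψ ∩ FlagBruhat.dualSchubertCell ω).Nonempty →
        FlagBruhat.IntersectTransversally
          (FlagBruhat.schubertCell ψ) (FlagBruhat.dualSchubertCell ω)) :=
  ⟨FlagBruhat.schubertCell_inter_nonempty_iff ψ ω,
    fun _ => FlagBruhat.intersectTransversally ψ ω⟩
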